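/- For a complex $2\times 2$ matrix $A$ let $W(A)=\{\langle Ax,x\rangle : x\in\mathbb C^2,\ \|x\|=1\}$ be its numerical range. A convex domain is an open convex set $\Omega\subset\mathbb C$ with $\emptyset\neq\Omega\neq\mathbb C$. All norms of matrices are operator norms with respect to Euclidean norms. For a matrix-valued rational function $R=(r_{ij})$ with complex coefficients, of size $m\times n$, without pole in the spectrum of $A$, $R(A)$ denotes the block matrix $(r_{ij}(A))$, an operator from $(\mathbb C^2)^n$ to $(\mathbb C^2)^m$; at a pole $z$ of $R$ we put $\|R(z)\|=\infty$. For a convex domain $\Omega$ define $$C(\Omega,2)=\sup\{\|r(A)\| : A\in\mathbb C^{2\times 2},\ \overline{W(A)}\subset\Omega,\ r \text{ a scalar rational function with } |r(z)|\le 1 \text{ for all } z\in\Omega\},$$ $$C_{cb}(\Omega,2)=\sup\{\|R(A)\| : A\in\mathbb C^{2\times 2},\ \overline{W(A)}\subset\Omega,\ R \text{ an } m\times n \text{ matrix-valued rational function with } \|R(z)\|\le 1 \text{ for all } z\in\Omega\},$$ where the second supremum is also taken over all sizes $m,n$. Then $$\sup_\Omega C_{cb}(\Omega,2)=\sup_\Omega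 C(\Omega,2)=2,$$ the suprema being over all convex domains $\Omega$. Moreover, for every complex $2\times2$ matrix $A$, the set $W(A)$ is a complete $2$-spectral set for $A$: for all $m,n$ and every $m\times n$ matrix-valued rational function $R$ without pole in the spectrum of $A$, $$\|R(A)\|\le 2\,\sup_{z\in W(A)}\|R(z)\|.$$ -/

import Mathlib

open scoped ENNReal Matrix.Norms.L2Operator

/-! All matrices over `ℂ` carry the operator norm induced by the Euclidean norms. -/

noncomputable section

namespace KSpectral

/-- The numerical range `W(A) = {⟨A x, x⟩ ; ‖x‖ = 1}` of a complex `d × d` matrix.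
The inner product of Mathlib is linear in its second argument. -/
def numericalRange {d : ℕ} (A : Matrix (Fin d) (Fin d) ℂ) : Set ℂ :=
  {w | ∃ x : EuclideanSpace ℂ (Fin d), ‖x‖ = 1 ∧
    inner ℂ x (Matrix.toEuclideanCLM (𝕜 := ℂ) A x) = w}

/-- A convex domain: a nonempty open convex subset of `ℂ`, different from `ℂ`. -/
structure IsConvexDomain (Ω : Set ℂ) : Prop where
  isOpen : IsOpen Ω
  convex : Convex ℝ Ω
  nonempty : Ω.Nonempty
  ne_univ : Ω ≠ Set.univ

/-- The rational function `r` has a pole at `z` (`num` and `denom` are coprime). -/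
def HasPole (r : RatFunc ℂ) (z : ℂ) : Prop :=
  r.denom.eval z = 0

/-- `r(A) = p(A) q(A)⁻¹` for the reduced fraction `r = p / q`. This is used for
rational functions `r` without pole in the spectrum of `A`; then `q(A)` is invertible. -/
def ratEval {d : ℕ} (r : RatFunc ℂ) (A : Matrix (Fin d) (Fin d) ℂ) :
    Matrix (Fin d) (Fin d) ℂ :=
  Polynomial.aeval A r.num * (Polynomial.aeval A r.denom)⁻¹

/-- The matrix valued rational function `R` has a pole at `z`: one of its entries does. -/
def MatHasPole {m n : ℕ} (R : Matrix (Fin m) (Fin n) (RatFunc ℂ)) (z : ℂ) : Prop :=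
  ∃ i j, HasPole (R i j) z

/-- The value `R(z)`, an `m × n` complex matrix, for `z` not a pole. -/
def matValue {m n : ℕ} (R : Matrix (Fin m) (Fin n) (RatFunc ℂ)) (z : ℂ) :
    Matrix (Fin m) (Fin n) ℂ :=
  R.map (fun r => r.eval (RingHom.id ℂ) z)

/-- `R(A)`: the block matrix with blocks `(R i j)(A)`, an operator from
`(ℂ^d)^n` to `(ℂ^d)^m`. -/
def matEval {d m n : ℕ} (R : Matrix (Fin m) (Fin n) (RatFunc ℂ))
    (A : Matrix (Fin d) (Fin d) ℂ) : Matrix (Fin m × Fin d) (Fin n × Fin d) ℂ :=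
  Matrix.comp (Fin m) (Fin n) (Fin d) (Fin d) ℂ (R.map (fun r => ratEval r A))

open Classical in
/-- `sup_{z ∈ X} |r(z)|`, where `|r(z)| = ∞` at a pole. -/
def ratSup (r : RatFunc ℂ) (X : Set ℂ) : ℝ≥0∞ :=
  ⨆ z ∈ X, if HasPole r z then ∞ else ‖r.eval (RingHom.id ℂ) z‖ₑ

open Classical in
/-- `sup_{z ∈ X} ‖R(z)‖`, where `‖R(z)‖ = ∞` at a pole. -/
def matSup {m n : ℕ} (R : Matrix (Fin m) (Fin n) (RatFunc ℂ)) (X : Set ℂ) : ℝ≥0∞ :=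
  ⨆ z ∈ X, if MatHasPole R z then ∞ else ‖matValue R z‖ₑ

/-- `C(Ω, d)`: the supremum of `‖r(A)‖` over the `d × d` matrices `A` whose numerical range
has its closure in `Ω` and the rational functions `r` with `|r| ≤ 1` on `Ω`. -/
def C (Ω : Set ℂ) (d : ℕ) : ℝ≥0∞ :=
  ⨆ (A : Matrix (Fin d) (Fin d) ℂ) (_ : closure (numericalRange A) ⊆ Ω)
    (r : RatFunc ℂ) (_ : ratSup r Ω ≤ 1), ‖ratEval r A‖ₑ

/-- `C_cb(Ω, d)`: the same with matrix valued rational functions of all sizes `m × n`. -/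
def Ccb (Ω : Set ℂ) (d : ℕ) : ℝ≥0∞ :=
  ⨆ (A : Matrix (Fin d) (Fin d) ℂ) (_ : closure (numericalRange A) ⊆ Ω)
    (m : ℕ) (n : ℕ) (R : Matrix (Fin m) (Fin n) (RatFunc ℂ)) (_ : matSup R Ω ≤ 1),
    ‖matEval R A‖ₑ

/-- `X` is a complete `K`-spectral set for `A`: `‖R(A)‖ ≤ K sup_X ‖R‖` for all matrix valued
rational functions `R` without pole in the spectrum of `A`. -/
def IsCompleteSpectralSet {d : ℕ} (K : ℝ≥0∞) (X : Set ℂ)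
    (A : Matrix (Fin d) (Fin d) ℂ) : Prop :=
  ∀ (m n : ℕ) (R : Matrix (Fin m) (Fin n) (RatFunc ℂ)),
    (∀ z ∈ spectrum ℂ A, ¬ MatHasPole R z) → ‖matEval R A‖ₑ ≤ K * matSup R X

end KSpectral

end

/-! A unitary conjugation brings `A` to the form `!![l, a; b, l]` with `‖b‖ ≤ ‖a‖`
(`exists_unitary_offdiag`). Its numerical range contains the ellipse of all `l + (a w + b conj w) /
2`, `‖w‖ ≤ 1`, whose foci are the eigenvalues. The upper bound 2 always comes from a diagonal
similarity with condition number at most 2.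

If `‖a‖ ≤ 4‖b‖`, conjugation by `diag(d, 1)` with `d ^ 2 = a / b`, `1 ≤ ‖d‖ ≤ 2`, turns the matrix
into a symmetric one with constant diagonal. That matrix is normal with eigenvalues in `W(A)`, so
the bound follows (`norm_matEval_offdiag_le_of_norm_le`).

If `4‖b‖ < ‖a‖`, this similarity is too costly. Instead an odd holomorphic map of the disc into the
ellipse (`ellipseMap`) yields a holomorphic family `C z = !![l, g z; g z * z ^ 2, l]`, which is
similar through `diag(z⁻¹, 1)` to a normal matrix with spectrum in `W(A)`. Hence `‖R(C z)‖ ≤ K /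
‖z‖`, and the maximum principle improves this to `‖R(C k)‖ ≤ K` at the point `k` of the disc that
the map sends to a focus. There `C k = !![l, a / 2; 2 * b, l]`, and `A` is its conjugate by `diag(2,
1)` (`norm_matEval_offdiag_le_of_lt_norm`).

The value 2 is approached on the unit disc by `r(z) = z` and the nilpotent matrices `!![0, 2 * s; 0,
0]`, `s → 1`. -/

namespace KSpectral

open Matrix Polynomial
open scoped Kronecker ComplexConjugate

/-! ### Euclidean operator norms of matrices -/

section Norms

variable {m n : Type*} [Fintype m] [Fintype n] [DecidableEq n]

lemma l2_opNorm_le_bound (A : Matrix m n ℂ) {K : ℝ} (hK : 0 ≤ K)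
    (h : ∀ x : EuclideanSpace ℂ n, ‖WithLp.toLp 2 (A *ᵥ x.ofLp)‖ ≤ K * ‖x‖) : ‖A‖ ≤ K :=
  ContinuousLinearMap.opNorm_le_bound _ hK h

lemma l2_norm_mulVec_le (A : Matrix m n ℂ) (x : n → ℂ) :
    ‖WithLp.toLp 2 (A *ᵥ x)‖ ≤ ‖A‖ * ‖WithLp.toLp 2 x‖ :=
  A.l2_opNorm_mulVec (WithLp.toLp 2 x)

lemma norm_entry_le (A : Matrix m n ℂ) (i : m) (j : n) : ‖A i j‖ ≤ ‖A‖ := by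
  have h := l2_norm_mulVec_le A (Pi.single j 1)
  have h2 := PiLp.norm_apply_le (p := 2) (WithLp.toLp 2 (A *ᵥ Pi.single j 1)) i
  have e : (A *ᵥ Pi.single j 1) i = A i j := by simp
  rw [PiLp.toLp_apply, e] at h2
  refine h2.trans (h.trans_eq ?_)
  simp

lemma norm_blockDiagonal_le {o : Type*} [Fintype o] [DecidableEq o] (M : o → Matrix m n ℂ)
    {K : ℝ} (hK : 0 ≤ K) (h : ∀ k, ‖M k‖ ≤ K) : ‖blockDiagonal M‖ ≤ K := by
  refine l2_opNorm_le_bound _ hK fun x => ?_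
  refine (sq_le_sq₀ (by positivity) (by positivity)).mp ?_
  have key : ∀ k, ∑ i, ‖(blockDiagonal M *ᵥ x.ofLp) (i, k)‖ ^ 2
      ≤ K ^ 2 * ∑ j, ‖x.ofLp (j, k)‖ ^ 2 := by
    intro k
    have h1 := (l2_norm_mulVec_le (M k) (fun j => x.ofLp (j, k))).trans
      (mul_le_mul_of_nonneg_right (h k) (norm_nonneg _))
    have h2 := pow_le_pow_left₀ (norm_nonneg _) h1 2
    rw [mul_pow, EuclideanSpace.norm_sq_eq, EuclideanSpace.norm_sq_eq] at h2
    have e : ∀ i, (blockDiagonal M *ᵥ x.ofLp) (i, k) = (M k *ᵥ fun j => x.ofLp (j, k)) i := by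
      intro i
      simp [mulVec, dotProduct, blockDiagonal_apply, Fintype.sum_prod_type, ite_mul]
    simpa only [e] using h2
  rw [mul_pow, EuclideanSpace.norm_sq_eq, EuclideanSpace.norm_sq_eq, Fintype.sum_prod_type_right,
    Fintype.sum_prod_type_right, Finset.mul_sum]
  exact Finset.sum_le_sum fun k _ => key k

end Norms

/-! ### Rational functional calculus under similarities -/

section Calculus

variable {d m n : ℕ}

lemma aeval_mul_mul (S T A : Matrix (Fin d) (Fin d) ℂ) (h : T * S = 1) (p : ℂ[X]) :
    aeval (S * A * T) p = S * aeval A p * T := by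
  have h' : S * T = 1 := mul_eq_one_comm.mp h
  induction p using Polynomial.induction_on' with
  | add p q hp hq => simp [hp, hq, mul_add, add_mul]
  | monomial k c =>
    have hk : (S * A * T) ^ k = S * A ^ k * T := by
      induction k with
      | zero => simp [h']
      | succ k ih =>
        rw [pow_succ, ih, pow_succ]
        calc S * A ^ k * T * (S * A * T) = S * A ^ k * (T * S) * A * T := by
              simp only [mul_assoc]
          _ = _ := by rw [h]; simp only [mul_assoc, mul_one]
    simp only [aeval_monomial, hk, Algebra.algebraMap_eq_smul_one, smul_mul_assoc, one_mul,
      mul_smul_comm]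

lemma ratEval_mul_mul (r : RatFunc ℂ) (S T A : Matrix (Fin d) (Fin d) ℂ) (h : T * S = 1) :
    ratEval r (S * A * T) = S * ratEval r A * T := by
  have hS : S⁻¹ = T := inv_eq_left_inv h
  have hT : T⁻¹ = S := inv_eq_right_inv h
  rw [ratEval, ratEval, aeval_mul_mul _ _ _ h, aeval_mul_mul _ _ _ h, Matrix.mul_inv_rev,
    Matrix.mul_inv_rev, hS, hT]
  calc S * aeval A r.num * T * (S * ((aeval A r.denom)⁻¹ * T))
      = S * aeval A r.num * (T * S) * (aeval A r.denom)⁻¹ * T := by simp only [mul_assoc]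
    _ = _ := by rw [h]; simp only [mul_assoc, mul_one]

lemma matEval_mul_mul (R : Matrix (Fin m) (Fin n) (RatFunc ℂ))
    (S T A : Matrix (Fin d) (Fin d) ℂ) (h : T * S = 1) :
    matEval R (S * A * T) = ((1 : Matrix (Fin m) (Fin m) ℂ) ⊗ₖ S) * matEval R A *
      ((1 : Matrix (Fin n) (Fin n) ℂ) ⊗ₖ T) := by
  ext ⟨i, a⟩ ⟨j, b⟩
  simp [matEval, ratEval_mul_mul _ _ _ _ h, mul_apply, Fintype.sum_prod_type, kroneckerMap_apply,
    one_apply, ite_mul, mul_ite, Finset.sum_ite_eq]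

lemma aeval_diagonal (p : ℂ[X]) (v : Fin d → ℂ) :
    aeval (diagonal v) p = diagonal fun i => p.eval (v i) := by
  have := aeval_algHom_apply (diagonalAlgHom (n := Fin d) ℂ (α := ℂ)) v p
  rw [diagonalAlgHom_apply, diagonalAlgHom_apply] at this
  rw [this]
  congr 1
  ext i
  have := aeval_algHom_apply (Pi.evalAlgHom ℂ (fun _ : Fin d => ℂ) i) v p
  rw [coe_aeval_eq_eval] at this
  exact this.symm

lemma ratEval_diagonal (r : RatFunc ℂ) (v : Fin d → ℂ) (hv : ∀ i, ¬ HasPole r (v i)) :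
    ratEval r (diagonal v) = diagonal fun i => r.eval (RingHom.id ℂ) (v i) := by
  have h : (diagonal fun i => r.denom.eval (v i))⁻¹ =
      diagonal fun i => (r.denom.eval (v i))⁻¹ := by
    refine inv_eq_right_inv ?_
    rw [diagonal_mul_diagonal, ← diagonal_one]
    congr 1
    ext i
    exact mul_inv_cancel₀ (hv i)
  rw [ratEval, aeval_diagonal, aeval_diagonal, h, diagonal_mul_diagonal]
  rfl

lemma norm_matEval_diagonal_le (R : Matrix (Fin m) (Fin n) (RatFunc ℂ)) (v : Fin d → ℂ)
    (hv : ∀ i, ¬ MatHasPole R (v i)) {K : ℝ} (hK : 0 ≤ K) (h : ∀ i, ‖matValue R (v i)‖ ≤ K) :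
    ‖matEval R (diagonal v)‖ ≤ K := by
  have : matEval R (diagonal v) = blockDiagonal fun i => matValue R (v i) := by
    ext ⟨i, a⟩ ⟨j, b⟩
    simp only [matEval, comp_apply, map_apply, blockDiagonal_apply, matValue]
    rw [ratEval_diagonal _ _ fun a ha => hv a ⟨i, j, ha⟩, diagonal_apply]
  rw [this]
  exact norm_blockDiagonal_le _ hK h

lemma norm_le_one_of_mem_unitary {ι : Type*} [Fintype ι] [DecidableEq ι] {U : Matrix ι ι ℂ}
    (hU : U ∈ unitary (Matrix ι ι ℂ)) : ‖U‖ ≤ 1 := by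
  rcases subsingleton_or_nontrivial (Matrix ι ι ℂ) with h | h
  · rw [Subsingleton.elim U 0, norm_zero]; exact zero_le_one
  · exact (CStarRing.norm_of_mem_unitary hU).le

lemma norm_matEval_mul_mul_le (R : Matrix (Fin m) (Fin n) (RatFunc ℂ))
    (S T A : Matrix (Fin d) (Fin d) ℂ) (h : T * S = 1) {s t : ℝ}
    (hs : ‖(1 : Matrix (Fin m) (Fin m) ℂ) ⊗ₖ S‖ ≤ s)
    (ht : ‖(1 : Matrix (Fin n) (Fin n) ℂ) ⊗ₖ T‖ ≤ t) :
    ‖matEval R (S * A * T)‖ ≤ s * t * ‖matEval R A‖ := by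
  rw [matEval_mul_mul R S T A h]
  have h0 : 0 ≤ s := (norm_nonneg _).trans hs
  calc _ ≤ _ := l2_opNorm_mul _ _
    _ ≤ s * ‖matEval R A‖ * t := by
      gcongr
      exact (l2_opNorm_mul _ _).trans (by gcongr)
    _ = _ := by ring

lemma norm_matEval_unitary_conj_le (R : Matrix (Fin m) (Fin n) (RatFunc ℂ))
    (U A : Matrix (Fin d) (Fin d) ℂ) (hU : U ∈ unitaryGroup (Fin d) ℂ) :
    ‖matEval R (U * A * star U)‖ ≤ ‖matEval R A‖ := by
  have hU' : star U ∈ unitaryGroup (Fin d) ℂ :=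
    mem_unitaryGroup_iff.mpr (by simpa using mem_unitaryGroup_iff'.mp hU)
  have := norm_matEval_mul_mul_le R U (star U) A (mem_unitaryGroup_iff'.mp hU)
    (norm_le_one_of_mem_unitary (kronecker_mem_unitary (one_mem _) hU))
    (norm_le_one_of_mem_unitary (kronecker_mem_unitary (one_mem _) hU'))
  simpa using this

lemma norm_one_kronecker_diagonal_le (v : Fin d → ℂ) {s : ℝ} (hs : 0 ≤ s) (h : ∀ i, ‖v i‖ ≤ s) :
    ‖(1 : Matrix (Fin m) (Fin m) ℂ) ⊗ₖ diagonal v‖ ≤ s := by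
  rw [← diagonal_one, diagonal_kronecker_diagonal, l2_opNorm_diagonal, pi_norm_le_iff_of_nonneg hs]
  rintro ⟨i, j⟩
  simpa using h j

/-- Bound for the functional calculus under a diagonal similarity. -/
lemma norm_matEval_smul_offdiag_le (R : Matrix (Fin m) (Fin n) (RatFunc ℂ)) (l p q u : ℂ)
    (hu : u ≠ 0) {s t : ℝ} (hs : ‖u‖ ≤ s) (hs1 : 1 ≤ s) (ht : ‖u‖⁻¹ ≤ t) (ht1 : 1 ≤ t) :
    ‖matEval R !![l, u * p; u⁻¹ * q, l]‖ ≤ s * t * ‖matEval R !![l, p; q, l]‖ := by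
  have e : !![l, u * p; u⁻¹ * q, l] = diagonal ![u, 1] * !![l, p; q, l] * diagonal ![u⁻¹, 1] := by
    ext i j
    fin_cases i <;> fin_cases j <;> simp [diagonal_mul, mul_diagonal] <;> field_simp
  rw [e]
  refine norm_matEval_mul_mul_le R _ _ _ ?_ (norm_one_kronecker_diagonal_le _ (by linarith) ?_)
    (norm_one_kronecker_diagonal_le _ (by linarith) ?_)
  · rw [diagonal_mul_diagonal, ← diagonal_one]
    congr 1
    ext i
    fin_cases i <;> simp [hu]
  · intro i; fin_cases i <;> simp [hs, hs1]
  · intro i; fin_cases i <;> simp [ht, ht1]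

/-- The matrix is normal even for complex `l` and `x`: the real unitary with columns `(1, ±1) / √2`
diagonalises it, with eigenvalues `l ± x`. -/
lemma norm_matEval_symm_le (R : Matrix (Fin m) (Fin n) (RatFunc ℂ)) (l x : ℂ)
    (hp : ¬ MatHasPole R (l + x)) (hm : ¬ MatHasPole R (l - x)) {K : ℝ}
    (hpK : ‖matValue R (l + x)‖ ≤ K) (hmK : ‖matValue R (l - x)‖ ≤ K) :
    ‖matEval R !![l, x; x, l]‖ ≤ K := by
  set c : ℂ := (((√2)⁻¹ : ℝ) : ℂ) with hc
  have hcc : c * c = 2⁻¹ := by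
    rw [hc, ← Complex.ofReal_mul, ← mul_inv, Real.mul_self_sqrt (by norm_num)]; simp
  have hstar : star (!![c, c; c, -c]) = !![c, c; c, -c] := by
    ext i j
    fin_cases i <;> fin_cases j <;> simp [hc, star_apply]
  have hU : !![c, c; c, -c] ∈ unitaryGroup (Fin 2) ℂ := by
    rw [mem_unitaryGroup_iff, hstar]
    ext i j
    fin_cases i <;> fin_cases j <;> simp [mul_apply, Fin.sum_univ_two, hcc] <;> norm_num
  have e : !![l, x; x, l] =
      !![c, c; c, -c] * diagonal ![l + x, l - x] * star (!![c, c; c, -c]) := by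
    rw [hstar]
    ext i j
    fin_cases i <;> fin_cases j <;> simp [mul_apply, Fin.sum_univ_two, vecMul_diagonal] <;>
      first | linear_combination (-2 * l) * hcc | linear_combination (-2 * x) * hcc
  rw [e]
  refine (norm_matEval_unitary_conj_le R _ _ hU).trans ?_
  refine norm_matEval_diagonal_le R _ ?_ ((norm_nonneg _).trans hpK) ?_
  · intro i; fin_cases i <;> simpa
  · intro i; fin_cases i <;> simpa

end Calculus

/-! ### Numerical range and normal form of a 2 × 2 matrix -/

section NumericalRange

lemma numericalRange_unitary_conj_subset {d : ℕ} (U A : Matrix (Fin d) (Fin d) ℂ)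
    (hU : U ∈ unitaryGroup (Fin d) ℂ) :
    numericalRange A ⊆ numericalRange (U * A * star U) := by
  rintro w ⟨x, hx, rfl⟩
  have hUU : star U * U = 1 := mem_unitaryGroup_iff'.mp hU
  have hin : ∀ y, inner ℂ (toEuclideanCLM (𝕜 := ℂ) U x) (toEuclideanCLM (𝕜 := ℂ) U y)
      = inner ℂ x y := by
    intro y
    rw [← ContinuousLinearMap.adjoint_inner_right, ← ContinuousLinearMap.star_eq_adjoint,
      ← map_star, ← mul_apply_eq_comp, ← map_mul, hUU, map_one,
      one_apply_eq_self]
  refine ⟨toEuclideanCLM (𝕜 := ℂ) U x, ?_, ?_⟩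
  · have h1 := hin x
    rw [inner_self_eq_norm_sq_to_K, inner_self_eq_norm_sq_to_K, hx] at h1
    have h2 : ‖toEuclideanCLM (𝕜 := ℂ) U x‖ ^ 2 = 1 := by
      have := congrArg Complex.re h1
      simpa [← Complex.ofReal_pow] using this
    exact (pow_eq_one_iff_of_nonneg (norm_nonneg _) two_ne_zero).mp h2
  · rw [← mul_apply_eq_comp, ← map_mul, mul_assoc, hUU, mul_one, map_mul,
      mul_apply_eq_comp, hin]

lemma mem_numericalRange_two {A : Matrix (Fin 2) (Fin 2) ℂ} {w : ℂ} :
    w ∈ numericalRange A ↔ ∃ x y : ℂ, ‖x‖ ^ 2 + ‖y‖ ^ 2 = 1 ∧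
      conj x * (A 0 0 * x + A 0 1 * y) + conj y * (A 1 0 * x + A 1 1 * y) = w := by
  have key : ∀ x y : ℂ, inner ℂ (WithLp.toLp 2 ![x, y])
      (toEuclideanCLM (𝕜 := ℂ) A (WithLp.toLp 2 ![x, y])) =
      conj x * (A 0 0 * x + A 0 1 * y) + conj y * (A 1 0 * x + A 1 1 * y) := by
    intro x y
    simp [PiLp.inner_apply, Fin.sum_univ_two]
    ring
  have hn : ∀ x y : ℂ, ‖(WithLp.toLp 2 ![x, y] : EuclideanSpace ℂ (Fin 2))‖ ^ 2 =
      ‖x‖ ^ 2 + ‖y‖ ^ 2 := by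
    intro x y
    simp [EuclideanSpace.norm_sq_eq, Fin.sum_univ_two]
  constructor
  · rintro ⟨v, hv, rfl⟩
    have e : v = WithLp.toLp 2 ![v 0, v 1] := by
      ext i; fin_cases i <;> rfl
    refine ⟨v 0, v 1, ?_, ?_⟩
    · rw [← hn, ← e, hv, one_pow]
    · rw [← key, ← e]
  · rintro ⟨x, y, hxy, rfl⟩
    refine ⟨WithLp.toLp 2 ![x, y], ?_, key x y⟩
    rw [← hn] at hxy
    exact (pow_eq_one_iff_of_nonneg (norm_nonneg _) two_ne_zero).mp hxy

/-- The numerical range of a matrix with constant diagonal is an ellipse. -/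
lemma add_mem_numericalRange (l a b w : ℂ) (hw : ‖w‖ ≤ 1) :
    l + (a / 2 * w + b / 2 * conj w) ∈ numericalRange !![l, a; b, l] := by
  rw [mem_numericalRange_two]
  -- `conj x * y = w / 2`
  obtain ⟨t, u, hu, ht0, ht, rfl⟩ : ∃ (t : ℝ) (u : ℂ), ‖u‖ = 1 ∧ 0 ≤ t ∧ t ≤ 1 ∧ w = t * u := by
    rcases eq_or_ne w 0 with rfl | h
    · exact ⟨0, 1, by simp, le_rfl, zero_le_one, by simp⟩
    · have : (‖w‖ : ℂ) ≠ 0 := by simpa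
      exact ⟨‖w‖, w / ‖w‖, by simp [h], norm_nonneg _, hw, by field_simp⟩
  -- The unit vector `(cos θ, u sin θ)` has mixed term `u sin (2θ) / 2`, so `sin (2θ) = t` is
  -- required.
  set θ := Real.arcsin t / 2 with hθ
  have hsin : Real.sin (2 * θ) = t := by
    rw [hθ, mul_div_cancel₀ _ two_ne_zero, Real.sin_arcsin (by linarith) ht]
  rw [Real.sin_two_mul] at hsin
  have hsc : (Real.sin θ : ℂ) ^ 2 + (Real.cos θ : ℂ) ^ 2 = 1 := by
    exact_mod_cast Real.sin_sq_add_cos_sq θ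
  have hsin' : 2 * (Real.sin θ : ℂ) * Real.cos θ = t := by exact_mod_cast hsin
  have huu : u * conj u = 1 := by rw [Complex.mul_conj']; simp [hu]
  refine ⟨Real.cos θ, Real.sin θ * u, ?_, ?_⟩
  · rw [norm_mul, hu, mul_one, Complex.norm_real, Complex.norm_real, Real.norm_eq_abs,
      Real.norm_eq_abs, sq_abs, sq_abs, Real.cos_sq_add_sin_sq]
  · simp only [of_apply, cons_val', cons_val_zero, cons_val_one, cons_val_fin_one, map_mul,
      Complex.conj_ofReal]
    linear_combination l * hsc + (a / 2 * u + b / 2 * conj u) * hsin' +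
      l * (Real.sin θ : ℂ) ^ 2 * huu

/-- Half the trace is a value of the quadratic form at some unit vector. Taking this vector as the
first basis vector fixes the first diagonal entry, and the trace forces the second. A swap of the
basis vectors orders `‖a‖` and `‖b‖`. -/
lemma exists_unitary_offdiag (A : Matrix (Fin 2) (Fin 2) ℂ) :
    ∃ U ∈ unitaryGroup (Fin 2) ℂ, ∃ l a b : ℂ, ‖b‖ ≤ ‖a‖ ∧ A = U * !![l, a; b, l] * star U := by
  -- it suffices to make the diagonal constant
  suffices H : ∃ U ∈ unitaryGroup (Fin 2) ℂ, ∃ l a b : ℂ, star U * A * U = !![l, a; b, l] by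
    have inv : ∀ U ∈ unitaryGroup (Fin 2) ℂ, ∀ B, star U * A * U = B → A = U * B * star U := by
      rintro U hU B rfl
      have h := mem_unitaryGroup_iff.mp hU
      calc A = (U * star U) * A * (U * star U) := by rw [h, one_mul, mul_one]
        _ = _ := by simp only [mul_assoc]
    obtain ⟨U, hU, l, a, b, h⟩ := H
    rcases le_total ‖b‖ ‖a‖ with hab | hab
    · exact ⟨U, hU, l, a, b, hab, inv U hU _ h⟩
    · have hP : !![(0 : ℂ), 1; 1, 0] ∈ unitaryGroup (Fin 2) ℂ := by
        rw [mem_unitaryGroup_iff]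
        ext i j
        fin_cases i <;> fin_cases j <;> simp [mul_apply, Fin.sum_univ_two, star_apply]
      refine ⟨U * !![0, 1; 1, 0], mul_mem hU hP, l, b, a, hab, inv _ (mul_mem hU hP) _ ?_⟩
      have : star (U * !![(0 : ℂ), 1; 1, 0]) * A * (U * !![0, 1; 1, 0]) =
          star !![(0 : ℂ), 1; 1, 0] * (star U * A * U) * !![0, 1; 1, 0] := by
        rw [star_mul]; simp only [mul_assoc]
      rw [this, h]
      ext i j
      fin_cases i <;> fin_cases j <;> simp [mul_apply, Fin.sum_univ_two, star_apply]
  -- a vector at which the traceless part vanishes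
  obtain ⟨x, y, hxy, h0⟩ : ∃ x y : ℂ, conj x * x + conj y * y = 1 ∧
      conj x * (A 0 0 * x + A 0 1 * y) + conj y * (A 1 0 * x + A 1 1 * y) =
        (A 0 0 + A 1 1) / 2 := by
    suffices H : ∃ x y : ℂ, (x ≠ 0 ∨ y ≠ 0) ∧
      conj x * (A 0 0 * x + A 0 1 * y) + conj y * (A 1 0 * x + A 1 1 * y) =
        (A 0 0 + A 1 1) / 2 * (conj x * x + conj y * y) by
      obtain ⟨x, y, hne, h⟩ := H
      set N : ℝ := ‖x‖ ^ 2 + ‖y‖ ^ 2 with hN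
      have hNpos : 0 < N := by
        rcases hne with h | h
        · have := norm_pos_iff.mpr h; positivity
        · have := norm_pos_iff.mpr h; positivity
      have hNe : conj x * x + conj y * y = N := by
        rw [Complex.conj_mul', Complex.conj_mul', hN]; push_cast; ring
      set s : ℂ := (((√N)⁻¹ : ℝ) : ℂ) with hs
      have hss : s * s * N = 1 := by
        rw [hs, ← Complex.ofReal_mul, ← mul_inv, Real.mul_self_sqrt hNpos.le,
          ← Complex.ofReal_mul, inv_mul_cancel₀ hNpos.ne', Complex.ofReal_one]
      have hsc : conj s = s := by rw [hs, Complex.conj_ofReal]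
      refine ⟨s * x, s * y, ?_, ?_⟩
      · rw [map_mul, map_mul, hsc]
        linear_combination (s * s) * hNe + hss
      · rw [map_mul, map_mul, hsc]
        rw [hNe] at h
        linear_combination (s * s) * h + (A 0 0 + A 1 1) / 2 * hss
    set p := (A 0 0 - A 1 1) / 2 with hp
    by_cases hp0 : p = 0
    · refine ⟨1, 0, Or.inl one_ne_zero, ?_⟩
      simp
      linear_combination hp0 - hp
    -- a phase for which the mixed term is a real multiple of `p`
    obtain ⟨ω, m, hω, hm⟩ : ∃ (ω : ℂ) (m : ℝ), conj ω * ω = 1 ∧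
        A 0 1 * ω + A 1 0 * conj ω = p * m := by
      -- The mixed term is a real multiple of `p` iff its product with `conj p` is real, and the
      -- imaginary part of that product is the imaginary part of `e * ω`.
      set e := A 0 1 * conj p - conj (A 1 0) * p with he
      obtain ⟨ω, hω, hr⟩ : ∃ ω : ℂ, conj ω * ω = 1 ∧ conj (e * ω) = e * ω := by
        by_cases h : e = 0
        · exact ⟨1, by simp, by simp [h]⟩
        · have h' : (‖e‖ : ℂ) ≠ 0 := by simpa
          have h2 := Complex.conj_mul' e
          refine ⟨conj e / ‖e‖, ?_, ?_⟩
          · simp only [map_div₀, Complex.conj_conj, Complex.conj_ofReal]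
            field_simp
            rw [← h2]; ring
          · simp only [map_mul, map_div₀, Complex.conj_conj, Complex.conj_ofReal]
            ring
      have hreal : conj (conj p * (A 0 1 * ω + A 1 0 * conj ω)) =
          conj p * (A 0 1 * ω + A 1 0 * conj ω) := by
        rw [he] at hr
        simp only [map_mul, map_add, map_sub, Complex.conj_conj] at hr ⊢
        linear_combination hr
      obtain ⟨r, hr'⟩ := Complex.conj_eq_iff_real.mp hreal
      have hpn : (‖p‖ : ℂ) ≠ 0 := by simpa
      refine ⟨ω, r / ‖p‖ ^ 2, hω, ?_⟩
      have hpc : conj p ≠ 0 := by simpa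
      apply mul_left_cancel₀ hpc
      have h2 := Complex.conj_mul' p
      push_cast
      rw [hr', ← mul_assoc, h2]
      field_simp
    -- At the vector `(α, ω)` with `α` real, the traceless part takes the value `p * (α ^ 2 + m * α
    -- - 1)`; `α` is a real root.
    set α : ℝ := (-m + √(m ^ 2 + 4)) / 2 with hα
    have hα2 : α ^ 2 + m * α - 1 = 0 := by
      have := Real.sq_sqrt (show 0 ≤ m ^ 2 + 4 by positivity)
      rw [hα]; nlinarith
    have hα2' : (α : ℂ) ^ 2 + m * α - 1 = 0 := by exact_mod_cast hα2
    refine ⟨α, ω, Or.inr ?_, ?_⟩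
    · rintro rfl; simp at hω
    · rw [Complex.conj_ofReal]
      linear_combination p * hα2' + α * hm + (-p) * hω + (-(α : ℂ) ^ 2 + conj ω * ω) * hp
  refine ⟨!![x, -conj y; y, conj x], ?_, (A 0 0 + A 1 1) / 2, ?_⟩
  · rw [mem_unitaryGroup_iff']
    ext i j
    fin_cases i <;> fin_cases j <;> simp [mul_apply, Fin.sum_univ_two, star_apply]
    · linear_combination hxy
    · ring
    · ring
    · linear_combination hxy
  · set U := !![x, -conj y; y, conj x] with hU
    refine ⟨(star U * A * U) 0 1, (star U * A * U) 1 0, ?_⟩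
    ext i j
    fin_cases i <;> fin_cases j
    · simp [hU, mul_apply, Fin.sum_univ_two, star_apply]
      linear_combination h0
    · rfl
    · rfl
    · simp [hU, mul_apply, Fin.sum_univ_two, star_apply]
      linear_combination (A 0 0 + A 1 1) * hxy - h0

end NumericalRange

/-! ### A holomorphic map from the disc into an ellipse -/

section Ellipse

lemma one_sub_ne_zero_of_norm_lt_one {u : ℂ} (hu : ‖u‖ < 1) : 1 - u ≠ 0 := by
  rw [sub_ne_zero]
  rintro rfl
  simp at hu

lemma norm_conj_mul_sq_lt_one {ε z : ℂ} (hε : ‖ε‖ < 1) (hz : ‖z‖ ≤ 1) :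
    ‖conj ε * z ^ 2‖ < 1 := by
  rw [norm_mul, RCLike.norm_conj, norm_pow]
  nlinarith [norm_nonneg z, norm_nonneg ε, mul_nonneg (norm_nonneg z) (norm_nonneg ε),
    pow_le_one₀ (norm_nonneg z) hz (n := 2)]

lemma norm_one_sub_conj_div_le {u : ℂ} (hu : ‖u‖ < 1) :
    ‖1 / (1 - u) - conj u / (1 - conj u)‖ * (1 - ‖u‖ ^ 2) ≤ 1 + ‖u‖ ^ 2 := by
  have h1 := one_sub_ne_zero_of_norm_lt_one hu
  have h2 : 1 - conj u ≠ 0 := one_sub_ne_zero_of_norm_lt_one (by rwa [RCLike.norm_conj])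
  have hD : (1 - u) * (1 - conj u) = ((1 - 2 * u.re + ‖u‖ ^ 2 : ℝ) : ℂ) := by
    have e1 := Complex.mul_conj' u
    have e2 := Complex.add_conj u
    push_cast at e2 ⊢
    linear_combination e1 - e2
  have hq : ‖u‖ ^ 2 = u.re ^ 2 + u.im ^ 2 := by
    rw [Complex.sq_norm, Complex.normSq_apply]; ring
  set D : ℝ := 1 - 2 * u.re + ‖u‖ ^ 2 with hDdef
  have hu0 := norm_nonneg u
  have hDpos : 0 < D := by
    have : u.re ≤ ‖u‖ := Complex.re_le_norm u
    nlinarith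
  have hN : 1 / (1 - u) - conj u / (1 - conj u) =
      (1 - 2 * conj u + ‖u‖ ^ 2) / (D : ℂ) := by
    rw [← hD, ← Complex.mul_conj' u]
    field_simp
    ring
  rw [hN, norm_div, Complex.norm_real, Real.norm_eq_abs, abs_of_pos hDpos, div_mul_eq_mul_div,
    div_le_iff₀ hDpos]
  refine le_of_sq_le_sq ?_ (by positivity)
  have hn : ‖1 - 2 * conj u + (‖u‖ : ℂ) ^ 2‖ ^ 2 = D ^ 2 + 4 * u.im ^ 2 := by
    have e : 1 - 2 * conj u + (‖u‖ : ℂ) ^ 2 = (D : ℂ) + ((2 * u.im : ℝ) : ℂ) * Complex.I := by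
      apply Complex.ext <;> simp [hDdef, ← Complex.ofReal_pow]
    rw [e, Complex.sq_norm, Complex.normSq_add_mul_I]
    ring
  rw [mul_pow, hn]
  -- The difference of the squared sides is a perfect square, which gives the sharp inequality.
  have : (1 + ‖u‖ ^ 2) ^ 2 * D ^ 2 - (D ^ 2 + 4 * u.im ^ 2) * (1 - ‖u‖ ^ 2) ^ 2 =
      4 * (2 * ‖u‖ ^ 2 - u.re * (1 + ‖u‖ ^ 2)) ^ 2 := by
    rw [hDdef, hq]; ring
  nlinarith [sq_nonneg (2 * ‖u‖ ^ 2 - u.re * (1 + ‖u‖ ^ 2))]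

/-- A holomorphic map of the unit disc into the ellipse `{w + ε * conj w | ‖w‖ ≤ 1}`. -/
noncomputable def ellipseMap (ε z : ℂ) : ℂ := (1 - 4 * ‖ε‖ ^ 2) * (z / (1 - conj ε * z ^ 2))

/-- If `ζ = w + ε * conj w`, then `ζ - ε * conj ζ = (1 - ‖ε‖ ^ 2) * w`, so the bound says that
`ellipseMap ε z` lies in the ellipse. On the circle `conj z = z⁻¹` reduces it to
`norm_one_sub_conj_div_le` and `(1 - 4t)(1 + t) ≤ (1 - t) ^ 2` with `t = ‖ε‖ ^ 2`. -/
lemma norm_ellipseMap_sub_le_of_norm_eq_one {ε z : ℂ} (hε : ‖ε‖ ≤ 1 / 4) (hz : ‖z‖ = 1) :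
    ‖ellipseMap ε z - ε * conj (ellipseMap ε z)‖ ≤ 1 - ‖ε‖ ^ 2 := by
  set u := conj ε * z ^ 2 with hu
  have hun : ‖u‖ = ‖ε‖ := by rw [hu, norm_mul, RCLike.norm_conj, norm_pow, hz]; ring
  have hzz : z * conj z = 1 := by rw [Complex.mul_conj']; simp [hz]
  have key := norm_one_sub_conj_div_le (u := u) (by rw [hun]; linarith)
  have e : ellipseMap ε z - ε * conj (ellipseMap ε z) =
      ((1 - 4 * ‖ε‖ ^ 2 : ℝ) : ℂ) * (z * (1 / (1 - u) - conj u / (1 - conj u))) := by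
    have hcu : z * conj u = ε * conj z := by
      rw [hu, map_mul, map_pow, Complex.conj_conj]
      linear_combination ε * conj z * hzz
    have : conj (ellipseMap ε z) = (1 - 4 * ‖ε‖ ^ 2) * (conj z / (1 - conj u)) := by
      simp [ellipseMap, hu, map_ofNat]
    rw [this, ellipseMap, ← hu]
    push_cast
    linear_combination (1 - 4 * (‖ε‖ : ℂ) ^ 2) * (1 - conj u)⁻¹ * hcu
  rw [hun] at key
  have h0 := norm_nonneg ε
  have hc : 0 ≤ 1 - 4 * ‖ε‖ ^ 2 := by nlinarith
  have hp : 0 < 1 - ‖ε‖ ^ 2 := by nlinarith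
  rw [e, norm_mul, norm_mul, hz, one_mul, Complex.norm_real, Real.norm_of_nonneg hc]
  refine le_of_mul_le_mul_right ?_ hp
  calc _ = (1 - 4 * ‖ε‖ ^ 2) * (‖1 / (1 - u) - conj u / (1 - conj u)‖ * (1 - ‖ε‖ ^ 2)) := by ring
    _ ≤ (1 - 4 * ‖ε‖ ^ 2) * (1 + ‖ε‖ ^ 2) := by gcongr
    _ ≤ _ := by nlinarith [sq_nonneg (‖ε‖ ^ 2), sq_nonneg ‖ε‖]

/-- The expression is not holomorphic in `z`, but its real part in a fixed direction `v` is the real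
part of a holomorphic function. The maximum principle for the exponential of that function extends
the bound from the circle to the disc. -/
lemma norm_ellipseMap_sub_le {ε z : ℂ} (hε : ‖ε‖ ≤ 1 / 4) (hz : ‖z‖ ≤ 1) :
    ‖ellipseMap ε z - ε * conj (ellipseMap ε z)‖ ≤ 1 - ‖ε‖ ^ 2 := by
  set η := ellipseMap ε z - ε * conj (ellipseMap ε z) with hη
  rcases eq_or_ne η 0 with h0 | h0
  · rw [h0, norm_zero]; nlinarith [norm_nonneg ε]
  set v : ℂ := η / ‖η‖ with hv
  have hn : (‖η‖ : ℂ) ≠ 0 := by simpa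
  have hv1 : ‖v‖ = 1 := by simp [hv, h0]
  have hre : ∀ ζ : ℂ, ((conj v - v * conj ε) * ζ).re = (conj v * (ζ - ε * conj ζ)).re := by
    intro ζ
    simp
    ring
  set F : ℂ → ℂ := fun z => Complex.exp ((conj v - v * conj ε) * ellipseMap ε z) with hF
  have hFn : ∀ z, ‖F z‖ = Real.exp (conj v * (ellipseMap ε z - ε * conj (ellipseMap ε z))).re := by
    intro z
    rw [hF, ← hre]; exact Complex.norm_exp _
  have hcl : closure (Metric.ball (0 : ℂ) 1) = Metric.closedBall 0 1 :=
    closure_ball _ one_ne_zero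
  have hdiff : DiffContOnCl ℂ F (Metric.ball 0 1) := by
    apply DifferentiableOn.diffContOnCl
    rw [hcl]
    intro y hy
    have := one_sub_ne_zero_of_norm_lt_one
      (norm_conj_mul_sq_lt_one (ε := ε) (z := y) (by linarith) (by simpa using hy))
    apply DifferentiableAt.differentiableWithinAt
    simp only [hF, ellipseMap]
    fun_prop (disch := assumption)
  have hmax := Complex.norm_le_of_forall_mem_frontier_norm_le Metric.isBounded_ball hdiff
    (C := Real.exp (1 - ‖ε‖ ^ 2)) (z := z) ?_ (by rw [hcl]; simpa using hz)
  · rw [hFn, Real.exp_le_exp, ← hη] at hmax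
    have : conj v * η = ‖η‖ := by
      rw [hv, map_div₀, Complex.conj_ofReal, div_mul_eq_mul_div, Complex.conj_mul']
      field_simp
    rwa [this, Complex.ofReal_re] at hmax
  · intro y hy
    rw [frontier_ball _ one_ne_zero, mem_sphere_zero_iff_norm] at hy
    rw [hFn, Real.exp_le_exp]
    refine (Complex.re_le_norm _).trans ?_
    rw [norm_mul, RCLike.norm_conj, hv1, one_mul]
    exact norm_ellipseMap_sub_le_of_norm_eq_one hε hy

lemma exists_ellipseMap_eq {ε z : ℂ} (hε : ‖ε‖ ≤ 1 / 4) (hz : ‖z‖ ≤ 1) :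
    ∃ w : ℂ, ‖w‖ ≤ 1 ∧ ellipseMap ε z = w + ε * conj w := by
  have hp : 0 < 1 - ‖ε‖ ^ 2 := by nlinarith [norm_nonneg ε]
  have hp' : (1 - (‖ε‖ : ℂ) ^ 2) ≠ 0 := by exact_mod_cast hp.ne'
  refine ⟨(ellipseMap ε z - ε * conj (ellipseMap ε z)) / (1 - ‖ε‖ ^ 2 : ℝ), ?_, ?_⟩
  · rw [norm_div, Complex.norm_real, Real.norm_of_nonneg hp.le, div_le_one hp]
    exact norm_ellipseMap_sub_le hε hz
  · have e := Complex.mul_conj' ε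
    simp only [map_div₀, map_sub, map_mul, Complex.conj_conj, Complex.conj_ofReal]
    push_cast
    field_simp
    linear_combination ellipseMap ε z * e

end Ellipse

/-! ### Holomorphy of the functional calculus along a matrix family -/

section Differentiability

lemma differentiableAt_aeval {d : ℕ} {C : ℂ → Matrix (Fin d) (Fin d) ℂ} {z : ℂ}
    (hC : DifferentiableAt ℂ C z) (p : ℂ[X]) :
    DifferentiableAt ℂ (fun z => aeval (C z) p) z := by
  induction p using Polynomial.induction_on' with
  | add p q hp hq =>
    simp only [map_add]
    exact hp.fun_add hq
  | monomial k c =>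
    simp only [aeval_monomial]
    exact (differentiableAt_const _).mul (hC.pow k)

lemma differentiableAt_matrix {m n : Type*} [Fintype m] [Fintype n] [DecidableEq m] [DecidableEq n]
    {M : ℂ → Matrix m n ℂ} {z : ℂ} (h : ∀ i j, DifferentiableAt ℂ (fun z => M z i j) z) :
    DifferentiableAt ℂ M z := by
  have e : M = fun z => ∑ i, ∑ j, M z i j • single i j (1 : ℂ) := by
    ext1 z
    conv_lhs => rw [matrix_eq_sum_single (M z)]
    simp
  rw [e]
  exact DifferentiableAt.fun_sum fun i _ => DifferentiableAt.fun_sum fun j _ =>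
    (h i j).smul_const _

lemma differentiableAt_entry {m n : Type*} [Fintype m] [Fintype n] [DecidableEq n]
    {M : ℂ → Matrix m n ℂ} {z : ℂ} (h : DifferentiableAt ℂ M z) (i : m) (j : n) :
    DifferentiableAt ℂ (fun z => M z i j) z :=
  (LinearMap.toContinuousLinearMap (entryLinearMap ℂ ℂ i j)).differentiableAt.comp z h

/-- By spectral mapping, 0 is not in the spectrum of `p(A)`. Size 0 is separate because the spectrum
is then empty. -/
lemma isUnit_aeval {d : ℕ} (A : Matrix (Fin d) (Fin d) ℂ) (p : ℂ[X])
    (h : ∀ z ∈ spectrum ℂ A, p.eval z ≠ 0) : IsUnit (aeval A p) := by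
  rcases subsingleton_or_nontrivial (Matrix (Fin d) (Fin d) ℂ) with hs | hs
  · exact isUnit_of_subsingleton _
  by_contra hu
  have h0 : (0 : ℂ) ∈ spectrum ℂ (aeval A p) := (spectrum.zero_mem_iff ℂ).mpr hu
  rw [spectrum.map_polynomial_aeval_of_nonempty _ _
    (spectrum.nonempty_of_isAlgClosed_of_finiteDimensional ℂ A)] at h0
  obtain ⟨z, hz, hz0⟩ := h0
  exact h z hz hz0

lemma differentiableAt_matEval {d m n : ℕ} (R : Matrix (Fin m) (Fin n) (RatFunc ℂ))
    {C : ℂ → Matrix (Fin d) (Fin d) ℂ} {z : ℂ} (hC : DifferentiableAt ℂ C z)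
    (h : ∀ w ∈ spectrum ℂ (C z), ¬ MatHasPole R w) :
    DifferentiableAt ℂ (fun z => matEval R (C z)) z := by
  refine differentiableAt_matrix ?_
  rintro ⟨i, a⟩ ⟨j, b⟩
  refine differentiableAt_entry (M := fun z => ratEval (R i j) (C z)) ?_ a b
  simp only [ratEval, nonsing_inv_eq_ringInverse]
  refine (differentiableAt_aeval hC _).mul ?_
  have h1 := differentiableAt_inverse (𝕜 := ℂ)
    (isUnit_aeval (C z) (R i j).denom fun w hw h0 => h w hw ⟨i, j, h0⟩)
  exact h1.comp (f := fun z => aeval (C z) (R i j).denom) z (differentiableAt_aeval hC _)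

end Differentiability

/-! ### The upper bound 2 -/

section UpperBound

lemma mem_spectrum_offdiag {l p q x w : ℂ} (hx : x ^ 2 = p * q)
    (hw : w ∈ spectrum ℂ !![l, p; q, l]) : w = l + x ∨ w = l - x := by
  rw [spectrum.mem_iff, isUnit_iff_isUnit_det, isUnit_iff_ne_zero, not_not, det_fin_two] at hw
  simp [algebraMap_eq_diagonal] at hw
  have : (w - (l + x)) * (w - (l - x)) = 0 := by linear_combination hw - hx
  rcases mul_eq_zero.mp this with h | h
  · exact Or.inl (sub_eq_zero.mp h)
  · exact Or.inr (sub_eq_zero.mp h)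

variable {m n : ℕ}

lemma norm_matEval_offdiag_le_of_norm_le (R : Matrix (Fin m) (Fin n) (RatFunc ℂ)) {K : ℝ}
    {l a b : ℂ} (hab : ‖b‖ ≤ ‖a‖) (hab4 : ‖a‖ ≤ 4 * ‖b‖)
    (hR : ∀ z ∈ numericalRange !![l, a; b, l], ¬ MatHasPole R z ∧ ‖matValue R z‖ ≤ K) :
    ‖matEval R !![l, a; b, l]‖ ≤ 2 * K := by
  have hK : 0 ≤ K := by
    have := hR _ (add_mem_numericalRange l a b 0 (by simp))
    exact (norm_nonneg _).trans this.2
  rcases eq_or_ne b 0 with rfl | hb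
  · obtain rfl : a = 0 := by simpa using hab4
    have h := hR l (by simpa using add_mem_numericalRange l 0 0 0 (by simp))
    have := norm_matEval_symm_le R l 0 (by simpa using h.1) (by simpa using h.1)
      (by simpa using h.2) (by simpa using h.2)
    linarith
  have ha : a ≠ 0 := by rintro rfl; simp at hab; exact hb hab
  have hb' : 0 < ‖b‖ := norm_pos_iff.mpr hb
  obtain ⟨d, hd⟩ := IsAlgClosed.exists_pow_nat_eq (a / b) (n := 2) (by norm_num)
  have hdn : ‖d‖ ^ 2 = ‖a‖ / ‖b‖ := by rw [← norm_pow, hd, norm_div]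
  have hd1 : 1 ≤ ‖d‖ := by
    have : 1 ≤ ‖d‖ ^ 2 := by rw [hdn, le_div_iff₀ hb', one_mul]; exact hab
    nlinarith [norm_nonneg d]
  have hd2 : ‖d‖ ≤ 2 := by
    have : ‖d‖ ^ 2 ≤ 4 := by rw [hdn, div_le_iff₀ hb']; exact hab4
    nlinarith [norm_nonneg d]
  have hd0 : d ≠ 0 := by rintro rfl; simp at hd1; linarith
  have hda : a = b * d ^ 2 := by rw [hd]; field_simp
  -- the eigenvalues are `l ± b * d`
  obtain ⟨w, hw1, hw⟩ : ∃ w : ℂ, ‖w‖ ≤ 1 ∧ a / 2 * w + b / 2 * conj w = b * d := by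
    have hpos : 0 < 1 + ‖d‖ ^ 2 := by positivity
    have hne : ((1 + ‖d‖ ^ 2 : ℝ) : ℂ) ≠ 0 := by exact_mod_cast hpos.ne'
    -- After division by `b / 2` the equation reads `d ^ 2 * w + conj w = 2 * d`; the bound `‖w‖ ≤
    -- 1` is `2‖d‖ ≤ 1 + ‖d‖ ^ 2`.
    refine ⟨2 * conj d / (1 + ‖d‖ ^ 2 : ℝ), ?_, ?_⟩
    · rw [norm_div, norm_mul, RCLike.norm_conj, Complex.norm_real, Real.norm_of_nonneg hpos.le,
        div_le_one hpos, Complex.norm_ofNat]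
      nlinarith [sq_nonneg (‖d‖ - 1)]
    · have e := Complex.mul_conj' d
      rw [hda, map_div₀, Complex.conj_ofReal, map_mul, Complex.conj_conj, map_ofNat]
      field_simp
      push_cast
      linear_combination e
  have hp := hR (l + b * d) (by rw [← hw]; exact add_mem_numericalRange l a b w hw1)
  have hm := hR (l - b * d) (by
    have := add_mem_numericalRange l a b (-w) (by rwa [norm_neg])
    convert this using 1
    rw [← hw, map_neg]; ring)
  have e : !![l, a; b, l] = !![l, d * (b * d); d⁻¹ * (b * d), l] := by
    congr 3
    · rw [hda]; ring_nf
    · field_simp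
  rw [e]
  refine (norm_matEval_smul_offdiag_le R l _ _ d hd0 (s := 2) (t := 1) hd2 (by norm_num)
    (inv_le_one_of_one_le₀ hd1) le_rfl).trans ?_
  rw [mul_one]
  gcongr
  exact norm_matEval_symm_le R l _ hp.1 hm.1 hp.2 hm.2

lemma norm_matEval_offdiag_le_of_lt_norm (R : Matrix (Fin m) (Fin n) (RatFunc ℂ)) {K : ℝ}
    {l a b : ℂ} (hab : 4 * ‖b‖ < ‖a‖)
    (hR : ∀ z ∈ numericalRange !![l, a; b, l], ¬ MatHasPole R z ∧ ‖matValue R z‖ ≤ K) :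
    ‖matEval R !![l, a; b, l]‖ ≤ 2 * K := by
  have ha : 0 < ‖a‖ := by linarith [norm_nonneg b]
  have ha0 : a ≠ 0 := norm_pos_iff.mp ha
  have hK : 0 ≤ K := by
    have := hR _ (add_mem_numericalRange l a b 0 (by simp))
    exact (norm_nonneg _).trans this.2
  set ε := b / a with hε
  have hε4 : ‖ε‖ < 1 / 4 := by rw [hε, norm_div, div_lt_iff₀ ha]; linarith
  -- The points `±k` are the foci of the ellipse `{w + ε * conj w}`, and the factor `1 - 4‖ε‖ ^ 2`
  -- in `ellipseMap` makes it fix them. The assumption `4‖b‖ < ‖a‖` is exactly `‖k‖ < 1`.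
  obtain ⟨k, hk⟩ := IsAlgClosed.exists_pow_nat_eq (4 * ε) (n := 2) (by norm_num)
  have hk1 : ‖k‖ < 1 := by
    have : ‖k‖ ^ 2 < 1 := by rw [← norm_pow, hk, norm_mul]; norm_num; linarith
    nlinarith [norm_nonneg k]
  have hmem : ∀ z : ℂ, ‖z‖ ≤ 1 → ∀ s : ℂ, ‖s‖ = 1 → conj s = s →
      l + s * (a / 2 * ellipseMap ε z) ∈ numericalRange !![l, a; b, l] := by
    intro z hz s hs hs'
    obtain ⟨w, hw, e⟩ := exists_ellipseMap_eq hε4.le hz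
    have := add_mem_numericalRange l a b (s * w) (by rw [norm_mul, hs, one_mul]; exact hw)
    convert this using 2
    rw [e, hε, map_mul, hs']
    field_simp
  have hplus : ∀ z : ℂ, ‖z‖ ≤ 1 →
      l + a / 2 * ellipseMap ε z ∈ numericalRange !![l, a; b, l] := fun z hz => by
    simpa using hmem z hz 1 (by simp) (by simp)
  have hminus : ∀ z : ℂ, ‖z‖ ≤ 1 →
      l - a / 2 * ellipseMap ε z ∈ numericalRange !![l, a; b, l] := fun z hz => by
    simpa [sub_eq_add_neg] using hmem z hz (-1) (by simp) (by simp)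
  -- This is `a / 2 * ellipseMap ε z / z` with the singularity at 0 removed, so `C z` has the
  -- eigenvalues `l ± a / 2 * ellipseMap ε z`.
  set g : ℂ → ℂ := fun z => a / 2 * ((1 - 4 * ‖ε‖ ^ 2) / (1 - conj ε * z ^ 2)) with hg
  have hgz : ∀ z, g z * z = a / 2 * ellipseMap ε z := by
    intro z
    simp only [hg, ellipseMap]
    ring
  set C : ℂ → Matrix (Fin 2) (Fin 2) ℂ := fun z => !![l, g z; g z * z ^ 2, l] with hC
  have hdiff : ∀ z : ℂ, ‖z‖ ≤ 1 → DifferentiableAt ℂ (fun z => matEval R (C z)) z := by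
    intro z hz
    have hden := one_sub_ne_zero_of_norm_lt_one
      (norm_conj_mul_sq_lt_one (ε := ε) (by linarith) hz)
    have hgd : DifferentiableAt ℂ g z := by
      simp only [hg]
      fun_prop (disch := assumption)
    refine differentiableAt_matEval R (differentiableAt_matrix ?_) ?_
    · intro i j
      fin_cases i <;> fin_cases j <;> simp [hC] <;> fun_prop
    · intro w hw
      rcases mem_spectrum_offdiag (x := a / 2 * ellipseMap ε z)
        (by rw [← hgz]; ring) hw with rfl | rfl
      · exact (hR _ (hplus z hz)).1
      · exact (hR _ (hminus z hz)).1
  have hbound : ∀ z : ℂ, z ≠ 0 → ‖z‖ ≤ 1 → ‖matEval R (C z)‖ ≤ ‖z‖⁻¹ * K := by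
    intro z hz0 hz
    have hz' : 0 < ‖z‖ := norm_pos_iff.mpr hz0
    have e : C z = !![l, z⁻¹ * (g z * z); z⁻¹⁻¹ * (g z * z), l] := by
      simp only [hC]
      congr 3
      · field_simp
      · rw [inv_inv]; ring_nf
    have h1 := norm_matEval_smul_offdiag_le R l (g z * z) (g z * z) z⁻¹ (inv_ne_zero hz0)
      (s := ‖z‖⁻¹) (t := 1) (by rw [norm_inv]) ((one_le_inv₀ hz').mpr hz) (by simpa) le_rfl
    rw [← e, mul_one] at h1
    refine h1.trans ?_
    gcongr
    rw [hgz]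
    exact norm_matEval_symm_le R l _ (hR _ (hplus z hz)).1 (hR _ (hminus z hz)).1
      (hR _ (hplus z hz)).2 (hR _ (hminus z hz)).2
  -- The bound `K / ‖z‖` is used only on circles `‖z‖ = r` around `k`; the maximum principle carries
  -- it inside, and `r → 1` removes the loss. This covers `k = 0`, where the similarity degenerates.
  have hCk : ‖matEval R (C k)‖ ≤ K := by
    have hr : ∀ r : ℝ, ‖k‖ < r → r < 1 → ‖matEval R (C k)‖ ≤ r⁻¹ * K := by
      intro r hkr hr1
      have hr0 : 0 < r := (norm_nonneg _).trans_lt hkr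
      refine Complex.norm_le_of_forall_mem_frontier_norm_le (f := fun z => matEval R (C z))
        (U := Metric.ball 0 r) Metric.isBounded_ball ?_ ?_ ?_
      · apply DifferentiableOn.diffContOnCl
        rw [closure_ball _ hr0.ne']
        intro z hz
        exact (hdiff z ((by simpa using hz : ‖z‖ ≤ r).trans hr1.le)).differentiableWithinAt
      · intro z hz
        rw [frontier_ball _ hr0.ne', mem_sphere_zero_iff_norm] at hz
        have := hbound z (by rintro rfl; simp at hz; linarith) (by linarith)
        rwa [hz] at this
      · exact subset_closure (by simpa using hkr)
    have hlim : Filter.Tendsto (fun r : ℝ => r⁻¹ * K) (nhdsWithin 1 (Set.Iio 1)) (nhds K) := by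
      have : ContinuousAt (fun r : ℝ => r⁻¹ * K) 1 :=
        (continuousAt_inv₀ one_ne_zero).mul continuousAt_const
      have h := this.tendsto.mono_left (nhdsWithin_le_nhds (s := Set.Iio 1))
      simpa using h
    refine ge_of_tendsto hlim ?_
    filter_upwards [Ioo_mem_nhdsLT hk1] with r hr'
    exact hr r hr'.1 hr'.2
  have hgk : g k = a / 2 := by
    have e : 1 - conj ε * k ^ 2 = 1 - 4 * (‖ε‖ : ℂ) ^ 2 := by
      rw [hk, ← Complex.conj_mul']; ring
    have hne : 1 - conj ε * k ^ 2 ≠ 0 := one_sub_ne_zero_of_norm_lt_one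
      (norm_conj_mul_sq_lt_one (by linarith) hk1.le)
    simp only [hg]
    rw [← e, div_self hne, mul_one]
  have e : !![l, a; b, l] = !![l, 2 * g k; 2⁻¹ * (g k * k ^ 2), l] := by
    have h1 : 2 * (a / 2) = a := by ring
    have h2 : 2⁻¹ * (a / 2 * (4 * (b / a))) = b := by field_simp; norm_num
    rw [hgk, hk, hε, h1, h2]
  rw [e]
  refine (norm_matEval_smul_offdiag_le R l _ _ 2 two_ne_zero (s := 2) (t := 1) (by simp)
    (by norm_num) (by norm_num) le_rfl).trans ?_
  rw [mul_one]
  gcongr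

/-- A finite supremum rules out poles on `W(A)` and serves as the real bound `K`; the normal form
then leaves the two cases above. -/
lemma enorm_matEval_le_two_mul (A : Matrix (Fin 2) (Fin 2) ℂ)
    (R : Matrix (Fin m) (Fin n) (RatFunc ℂ)) :
    ‖matEval R A‖ₑ ≤ 2 * matSup R (numericalRange A) := by
  rcases eq_or_ne (matSup R (numericalRange A)) ∞ with htop | htop
  · rw [htop, ENNReal.mul_top two_ne_zero]; exact le_top
  set K : ℝ := (matSup R (numericalRange A)).toReal with hK
  have hR : ∀ z ∈ numericalRange A, ¬ MatHasPole R z ∧ ‖matValue R z‖ ≤ K := by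
    intro z hz
    classical
    have h : (if MatHasPole R z then ∞ else ‖matValue R z‖ₑ) ≤ matSup R (numericalRange A) :=
      le_iSup₂_of_le z hz le_rfl
    have hp : ¬ MatHasPole R z := by
      intro hp
      rw [if_pos hp, top_le_iff] at h
      exact htop h
    rw [if_neg hp] at h
    refine ⟨hp, ?_⟩
    rw [hK, ← toReal_enorm]
    exact ENNReal.toReal_mono htop h
  obtain ⟨U, hU, l, a, b, hab, hA⟩ := exists_unitary_offdiag A
  have hR' : ∀ z ∈ numericalRange !![l, a; b, l], ¬ MatHasPole R z ∧ ‖matValue R z‖ ≤ K := by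
    intro z hz
    exact hR z (hA ▸ numericalRange_unitary_conj_subset U _ hU hz)
  have hmain : ‖matEval R A‖ ≤ 2 * K := by
    rw [hA]
    refine (norm_matEval_unitary_conj_le R U _ hU).trans ?_
    rcases le_or_gt ‖a‖ (4 * ‖b‖) with h | h
    · exact norm_matEval_offdiag_le_of_norm_le R hab h hR'
    · exact norm_matEval_offdiag_le_of_lt_norm R h hR'
  rw [← ofReal_norm]
  refine (ENNReal.ofReal_le_ofReal hmain).trans_eq ?_
  rw [ENNReal.ofReal_mul zero_le_two, hK, ENNReal.ofReal_toReal htop]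
  simp

end UpperBound

/-! ### The constants `C` and `Ccb`, and sharpness on the disc -/

section Constants

lemma Ccb_two_le (Ω : Set ℂ) : Ccb Ω 2 ≤ 2 := by
  refine iSup₂_le fun A hA => iSup_le fun m => iSup_le fun n => iSup₂_le fun R hR => ?_
  have hsub : numericalRange A ⊆ Ω := subset_closure.trans hA
  have hsup : matSup R (numericalRange A) ≤ 1 := (biSup_mono hsub).trans hR
  calc _ ≤ _ := enorm_matEval_le_two_mul A R
    _ ≤ 2 * 1 := by gcongr
    _ = 2 := mul_one 2

lemma isConvexDomain_ball : IsConvexDomain (Metric.ball (0 : ℂ) 1) where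
  isOpen := Metric.isOpen_ball
  convex := convex_ball 0 1
  nonempty := ⟨0, by simp⟩
  ne_univ := fun h => by
    have : (1 : ℂ) ∈ Metric.ball (0 : ℂ) 1 := h ▸ Set.mem_univ _
    simp at this

lemma closure_numericalRange_nilpotent_subset {s : ℝ} (hs0 : 0 ≤ s) (hs : s < 1) :
    closure (numericalRange !![0, 2 * (s : ℂ); 0, 0]) ⊆ Metric.ball 0 1 := by
  refine (closure_minimal ?_ Metric.isClosed_closedBall).trans (Metric.closedBall_subset_ball hs)
  intro w hw
  obtain ⟨x, y, hxy, rfl⟩ := mem_numericalRange_two.mp hw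
  rw [mem_closedBall_zero_iff]
  simp only [of_apply, cons_val', cons_val_zero, cons_val_one, cons_val_fin_one, zero_mul,
    zero_add, mul_zero, add_zero, norm_mul, RCLike.norm_conj, Complex.norm_real, Complex.norm_ofNat,
    Real.norm_of_nonneg hs0]
  -- The form has modulus `2 * s * ‖x‖ * ‖y‖`, at most `s` for a unit vector.
  nlinarith [mul_nonneg hs0 (sq_nonneg (‖x‖ - ‖y‖))]

lemma ratEval_X {d : ℕ} (A : Matrix (Fin d) (Fin d) ℂ) : ratEval RatFunc.X A = A := by
  simp [ratEval]

lemma not_hasPole_X (z : ℂ) : ¬ HasPole RatFunc.X z := by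
  simp [HasPole]

lemma two_mul_le_C_ball {s : ℝ} (hs0 : 0 ≤ s) (hs : s < 1) :
    ENNReal.ofReal (2 * s) ≤ C (Metric.ball 0 1) 2 := by
  have hX : ratSup RatFunc.X (Metric.ball 0 1) ≤ 1 := by
    refine iSup₂_le fun z hz => ?_
    rw [if_neg (not_hasPole_X z), RatFunc.eval_X, ← ofReal_norm]
    exact ENNReal.ofReal_le_one.mpr (mem_ball_zero_iff.mp hz).le
  refine le_trans ?_ (le_iSup₂_of_le _ (closure_numericalRange_nilpotent_subset hs0 hs)
    (le_iSup₂_of_le RatFunc.X hX le_rfl))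
  rw [ratEval_X, ← ofReal_norm]
  refine ENNReal.ofReal_le_ofReal ?_
  have := norm_entry_le !![0, 2 * (s : ℂ); 0, 0] 0 1
  simpa [abs_of_nonneg hs0] using this

lemma norm_matValue_const (r : RatFunc ℂ) (z : ℂ) :
    ‖matValue (of fun _ _ : Fin 1 => r) z‖ ≤ ‖r.eval (RingHom.id ℂ) z‖ := by
  have : matValue (of fun _ _ : Fin 1 => r) z = diagonal fun _ => r.eval (RingHom.id ℂ) z := by
    ext i j
    fin_cases i; fin_cases j
    simp [matValue]
  rw [this, l2_opNorm_diagonal]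
  exact pi_norm_const_le _

/-- With a single block, `Fin 1 × Fin d` indexes the same vectors as `Fin d`, so the block matrix
acts as `r(A)`. -/
lemma norm_le_norm_matEval_const {d : ℕ} (r : RatFunc ℂ) (A : Matrix (Fin d) (Fin d) ℂ) :
    ‖ratEval r A‖ ≤ ‖matEval (of fun _ _ : Fin 1 => r) A‖ := by
  refine l2_opNorm_le_bound _ (norm_nonneg _) fun x => ?_
  have h := l2_norm_mulVec_le (matEval (of fun _ _ : Fin 1 => r) A) (fun q => x.ofLp q.2)
  have h1 : ∀ i a, (matEval (of fun _ _ : Fin 1 => r) A *ᵥ fun q => x.ofLp q.2) (i, a) =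
      (ratEval r A *ᵥ x.ofLp) a := by
    intro i a
    simp [matEval, mulVec, dotProduct, Fintype.sum_prod_type]
  simp only [EuclideanSpace.norm_eq, Fintype.sum_prod_type, h1] at h ⊢
  simpa using h

lemma C_le_Ccb (Ω : Set ℂ) (d : ℕ) : C Ω d ≤ Ccb Ω d := by
  refine iSup₂_le fun A hA => iSup₂_le fun r hr => ?_
  have hR : matSup (of fun _ _ : Fin 1 => r) Ω ≤ 1 := by
    refine le_trans (iSup₂_mono fun z hz => ?_) hr
    have hiff : MatHasPole (of fun _ _ : Fin 1 => r) z ↔ HasPole r z :=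
      ⟨fun ⟨_, _, h⟩ => h, fun h => ⟨0, 0, h⟩⟩
    by_cases h : HasPole r z
    · rw [if_pos h]; exact le_top
    · rw [if_neg h, if_neg (mt hiff.mp h), ← ofReal_norm, ← ofReal_norm]
      exact ENNReal.ofReal_le_ofReal (norm_matValue_const r z)
  refine le_trans ?_ (le_iSup₂_of_le A hA (le_iSup_of_le 1 (le_iSup_of_le 1
    (le_iSup₂_of_le (of fun _ _ => r) hR le_rfl))))
  rw [← ofReal_norm, ← ofReal_norm]
  exact ENNReal.ofReal_le_ofReal (norm_le_norm_matEval_const r A)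

lemma two_le_C_ball : 2 ≤ C (Metric.ball 0 1) 2 := by
  have hlim : Filter.Tendsto (fun s : ℝ => ENNReal.ofReal (2 * s)) (nhdsWithin 1 (Set.Iio 1))
      (nhds 2) := by
    have : Continuous fun s : ℝ => ENNReal.ofReal (2 * s) :=
      ENNReal.continuous_ofReal.comp (continuous_const.mul continuous_id)
    have h := (this.tendsto 1).mono_left (nhdsWithin_le_nhds (s := Set.Iio 1))
    simpa using h
  refine le_of_tendsto hlim ?_
  filter_upwards [Ioo_mem_nhdsLT zero_lt_one] with s hs
  exact two_mul_le_C_ball hs.1.le hs.2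

end Constants

end KSpectral

theorem mainTheorem4 :
    (⨆ (Ω : Set ℂ) (_ : KSpectral.IsConvexDomain Ω), KSpectral.Ccb Ω 2)
        = (⨆ (Ω : Set ℂ) (_ : KSpectral.IsConvexDomain Ω), KSpectral.C Ω 2) ∧
      (⨆ (Ω : Set ℂ) (_ : KSpectral.IsConvexDomain Ω), KSpectral.C Ω 2) = 2 ∧
      ∀ A : Matrix (Fin 2) (Fin 2) ℂ,
        KSpectral.IsCompleteSpectralSet 2 (KSpectral.numericalRange A) A := by
  have hlow : 2 ≤ ⨆ (Ω : Set ℂ) (_ : KSpectral.IsConvexDomain Ω), KSpectral.C Ω 2 :=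
    le_iSup₂_of_le _ KSpectral.isConvexDomain_ball KSpectral.two_le_C_ball
  have hmono : (⨆ (Ω : Set ℂ) (_ : KSpectral.IsConvexDomain Ω), KSpectral.C Ω 2) ≤
      ⨆ (Ω : Set ℂ) (_ : KSpectral.IsConvexDomain Ω), KSpectral.Ccb Ω 2 :=
    iSup₂_mono fun Ω _ => KSpectral.C_le_Ccb Ω 2
  have hup : (⨆ (Ω : Set ℂ) (_ : KSpectral.IsConvexDomain Ω), KSpectral.Ccb Ω 2) ≤ 2 :=
    iSup₂_le fun Ω _ => KSpectral.Ccb_two_le Ω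
  exact ⟨le_antisymm (hup.trans hlow) hmono, le_antisymm (hmono.trans hup) hlow,
    fun A _ _ R _ => KSpectral.enorm_matEval_le_two_mul A R⟩
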